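/- Let $K$ be a field, $K\langle X\rangle=K\langle X_1,\dots,X_n\rangle$ the free associative $K$-algebra, and $\mathcal B$ its basis of monomials (words). Assign to each $X_i$ a positive integer degree, extended additively to a degree function $d$ on $\mathcal B$; let $K\langle X\rangle_p$ be the span of the words of degree $p$ and $F_pK\langle X\rangle=\bigoplus_{q\le p}K\langle X\rangle_q$ for $p\in\mathbb N$. Let $\prec_{gr}$ be an $\mathbb N$-graded lexicographic ordering on $\mathcal B$: $u\prec_{gr}v$ if and only if $d(u)<d(v)$, or $d(u)=d(v)$ and $u$ is smaller than $v$ in the lexicographic ordering of words determined by some total ordering of the letters. For a set $S\subseteq K\langle X\rangle$ let $\mathbf{LM}(S)$ be the set of leading (that is, $\prec_{gr}$-largest) monomials of the nonzero elements of $S$, and for a subset $U$ let $\langle U\rangle$ denote the two-sided ideal generated by $U$. Let $\mathcal G$ be a finite (not necessarily homogeneous) Gröbner basis of the ideal $I=\langle\mathcal G\rangle$ with respect to $\prec_{gr}$, i.e. $\mathcal G\subseteq I\setminus\{0\}$ and $\langle\mathbf{LM}(I)\rangle=\langle\mathbf{LM}(\mathcal G)\rangle$. Assume that $\mathbf{LM}(\mathcal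 G)\cap\{X_1,\dots,X_n\}=\emptyset$ and that $\mathbf{LM}(\mathcal G)$ is reduced, i.e. no element of $\mathbf{LM}(\mathcal G)$ is a factor (contiguous subword) of a different element of $\mathbf{LM}(\mathcal G)$. Let $A=K\langle X\rangle/I$ with the filtration $F_pA=(F_pK\langle X\rangle+I)/I$, $p\in\mathbb N$, and let $\widetilde A=\bigoplus_{p\in\mathbb N}F_pA$ be its Rees algebra, with the multiplication induced by $F_pA\cdot F_qA\subseteq F_{p+q}A$. If the monomial algebra $R=K\langle X\rangle/\langle\mathbf{LM}(\mathcal G)\rangle$ is semi-prime (for $a\in R$, $aRa=0$ implies $a=0$), then $\widetilde A$ is semiprimitive, i.e. its Jacobson radical is zero. -/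

import Mathlib

noncomputable section

open scoped DirectSum

namespace WeightedFreeAlgebra

/-- The word `w = X_{i_1} ⋯ X_{i_s}`, seen as an element of the free algebra `K⟨X_1, …, X_n⟩`.
These elements form the standard `K`-basis of monomials. -/
def monomial (K : Type*) [Field K] {n : ℕ} (w : FreeMonoid (Fin n)) : FreeAlgebra K (Fin n) :=
  FreeMonoid.lift (FreeAlgebra.ι K) w

/-- The coefficients of an element of the free algebra in the standard basis of monomials. -/
def coeffs {K : Type*} [Field K] {n : ℕ} (f : FreeAlgebra K (Fin n)) : FreeMonoid (Fin n) →₀ K :=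
  (FreeAlgebra.equivMonoidAlgebraFreeMonoid f).coeff

/-- The degree of a word when the letter `X_i` has degree `d i`. -/
def wdeg {n : ℕ} (d : Fin n → ℕ) (w : FreeMonoid (Fin n)) : ℕ :=
  (w.toList.map d).sum

/-- The graded lexicographic (strict) ordering of words: compare degrees first, and words of the
same degree lexicographically from left to right, with respect to the ordering `r` of the
letters. -/
def gradedLex {n : ℕ} (d : Fin n → ℕ) (r : Fin n → Fin n → Prop) (u v : FreeMonoid (Fin n)) :
    Prop :=
  wdeg d u < wdeg d v ∨ (wdeg d u = wdeg d v ∧ List.Lex r u.toList v.toList)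

/-- `w` is the leading monomial of `f`: it occurs in `f`, and it is larger than every other word
that occurs in `f`. (The element `0` has no leading monomial.) -/
def IsLeadingMonomial {K : Type*} [Field K] {n : ℕ}
    (lt : FreeMonoid (Fin n) → FreeMonoid (Fin n) → Prop)
    (f : FreeAlgebra K (Fin n)) (w : FreeMonoid (Fin n)) : Prop :=
  w ∈ (coeffs f).support ∧ ∀ u ∈ (coeffs f).support, u ≠ w → lt u w

/-- The set `LM(S)` of leading monomials of the nonzero elements of `S`. -/
def leadingMonomials {K : Type*} [Field K] {n : ℕ}
    (lt : FreeMonoid (Fin n) → FreeMonoid (Fin n) → Prop)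
    (S : Set (FreeAlgebra K (Fin n))) : Set (FreeMonoid (Fin n)) :=
  {w | ∃ f ∈ S, IsLeadingMonomial lt f w}

/-- The quotient algebra `A = K⟨X⟩ / I` by a two-sided ideal `I`. -/
def QuotAlg {K : Type*} [Field K] {n : ℕ} (I : TwoSidedIdeal (FreeAlgebra K (Fin n))) : Type _ :=
  I.ringCon.Quotient

instance {K : Type*} [Field K] {n : ℕ} (I : TwoSidedIdeal (FreeAlgebra K (Fin n))) :
    Ring (QuotAlg I) :=
  inferInstanceAs (Ring I.ringCon.Quotient)

instance {K : Type*} [Field K] {n : ℕ} (I : TwoSidedIdeal (FreeAlgebra K (Fin n))) :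
    Algebra K (QuotAlg I) :=
  inferInstanceAs (Algebra K I.ringCon.Quotient)

/-- The quotient map `K⟨X⟩ → K⟨X⟩ / I`. -/
def QuotAlg.mk {K : Type*} [Field K] {n : ℕ} (I : TwoSidedIdeal (FreeAlgebra K (Fin n))) :
    FreeAlgebra K (Fin n) →ₐ[K] QuotAlg I :=
  RingCon.mkₐ K I.ringCon

theorem QuotAlg.mk_surjective {K : Type*} [Field K] {n : ℕ}
    (I : TwoSidedIdeal (FreeAlgebra K (Fin n))) : Function.Surjective (QuotAlg.mk I) :=
  RingCon.mkₐ_surjective (α := K) I.ringCon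

theorem QuotAlg.mk_eq_zero {K : Type*} [Field K] {n : ℕ}
    (I : TwoSidedIdeal (FreeAlgebra K (Fin n))) (f : FreeAlgebra K (Fin n)) :
    QuotAlg.mk I f = 0 ↔ f ∈ I :=
  (RingCon.eq I.ringCon).trans (TwoSidedIdeal.mem_iff I f).symm

/-- The two-sided ideal of the free algebra generated by a set of words. -/
def monomialIdeal (K : Type*) [Field K] {n : ℕ} (Ω : Set (FreeMonoid (Fin n))) :
    TwoSidedIdeal (FreeAlgebra K (Fin n)) :=
  TwoSidedIdeal.span (monomial K '' Ω)

/-- `G` is a Gröbner basis of the two-sided ideal `I`: it consists of nonzero elements of `I`, and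
the leading monomials of `G` and those of `I` generate the same two-sided ideal. -/
def IsGroebnerBasis {K : Type*} [Field K] {n : ℕ}
    (lt : FreeMonoid (Fin n) → FreeMonoid (Fin n) → Prop)
    (I : TwoSidedIdeal (FreeAlgebra K (Fin n))) (G : Set (FreeAlgebra K (Fin n))) : Prop :=
  (∀ g ∈ G, g ∈ I ∧ g ≠ 0) ∧
    monomialIdeal K (leadingMonomials lt {f | f ∈ I}) = monomialIdeal K (leadingMonomials lt G)

/-- `v` divides `u` as a word: `v` is a factor (a contiguous subword) of `u`. -/
def WordDvd {n : ℕ} (v u : FreeMonoid (Fin n)) : Prop :=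
  ∃ w s : FreeMonoid (Fin n), u = w * v * s

/-- A set of words is reduced if none of its elements divides another one. -/
def IsReducedWordSet {n : ℕ} (Ω : Set (FreeMonoid (Fin n))) : Prop :=
  ∀ v ∈ Ω, ∀ u ∈ Ω, v ≠ u → ¬ WordDvd v u

/-- A ring `R` is semi-prime if `a R a = 0` implies `a = 0`. -/
def IsSemiprimeRing (R : Type*) [Ring R] : Prop :=
  ∀ a : R, (∀ x : R, a * x * a = 0) → a = 0

/-- A ring is semiprimitive if its Jacobson radical is zero. -/
def IsSemiprimitiveRing (R : Type*) [Ring R] : Prop :=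
  Ring.jacobson R = ⊥

/-- The homogeneous part `K⟨X⟩_p` of degree `p`: the span of the words of degree `p`. -/
def homogeneousPart (K : Type*) [Field K] {n : ℕ} (d : Fin n → ℕ) (p : ℕ) :
    Submodule K (FreeAlgebra K (Fin n)) :=
  Submodule.span K (monomial K '' {w | wdeg d w = p})

/-- The grading filtration `F_p K⟨X⟩ = ⨁_{q ≤ p} K⟨X⟩_q` of the free algebra. -/
def freeFiltration (K : Type*) [Field K] {n : ℕ} (d : Fin n → ℕ) (p : ℕ) :
    Submodule K (FreeAlgebra K (Fin n)) :=
  ⨆ q ≤ p, homogeneousPart K d q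

/-- The induced filtration `F_p A = (F_p K⟨X⟩ + I) / I` of `A = K⟨X⟩ / I`, that is, the image of
`F_p K⟨X⟩` in `A`. -/
def quotFiltration {K : Type*} [Field K] {n : ℕ} (d : Fin n → ℕ)
    (I : TwoSidedIdeal (FreeAlgebra K (Fin n))) (p : ℕ) : Submodule K (QuotAlg I) :=
  (freeFiltration K d p).map (QuotAlg.mk I).toLinearMap

theorem wdeg_mul {n : ℕ} (d : Fin n → ℕ) (u v : FreeMonoid (Fin n)) :
    wdeg d (u * v) = wdeg d u + wdeg d v := by
  simp [wdeg]

theorem one_mem_freeFiltration (K : Type*) [Field K] {n : ℕ} (d : Fin n → ℕ) :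
    (1 : FreeAlgebra K (Fin n)) ∈ freeFiltration K d 0 := by
  refine Submodule.mem_iSup_of_mem 0 (Submodule.mem_iSup_of_mem le_rfl ?_)
  exact Submodule.subset_span ⟨1, by simp [wdeg], by simp [monomial]⟩

theorem mul_mem_freeFiltration (K : Type*) [Field K] {n : ℕ} (d : Fin n → ℕ) {p q : ℕ}
    {f g : FreeAlgebra K (Fin n)} (hf : f ∈ freeFiltration K d p)
    (hg : g ∈ freeFiltration K d q) : f * g ∈ freeFiltration K d (p + q) := by
  have h : freeFiltration K d p * freeFiltration K d q ≤ freeFiltration K d (p + q) := by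
    simp only [freeFiltration, Submodule.iSup_mul, Submodule.mul_iSup, iSup_le_iff]
    intro i hi j hj
    refine le_trans ?_ (le_iSup₂_of_le (i + j) (by omega) le_rfl)
    rw [homogeneousPart, homogeneousPart, Submodule.span_mul_span, Submodule.span_le]
    rintro _ ⟨_, ⟨u, hu, rfl⟩, _, ⟨v, hv, rfl⟩, rfl⟩
    refine Submodule.subset_span ⟨u * v, ?_, by simp [monomial]⟩
    change wdeg d (u * v) = i + j
    rw [wdeg_mul, show wdeg d u = _ from hu, show wdeg d v = _ from hv]
    omega
  exact h (Submodule.mul_mem_mul hf hg)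

instance quotFiltration_gradedMonoid {K : Type*} [Field K] {n : ℕ} (d : Fin n → ℕ)
    (I : TwoSidedIdeal (FreeAlgebra K (Fin n))) : SetLike.GradedMonoid (quotFiltration d I) where
  one_mem := ⟨1, one_mem_freeFiltration K d, map_one (QuotAlg.mk I)⟩
  mul_mem := by
    rintro p q _ _ ⟨f, hf, rfl⟩ ⟨g, hg, rfl⟩
    exact ⟨f * g, mul_mem_freeFiltration K d hf hg, map_mul (QuotAlg.mk I) f g⟩

/-- The Rees algebra `⨁_p F_p A` of `A = K⟨X⟩ / I`. Its multiplication is the one induced by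
`F_p A · F_q A ⊆ F_{p+q} A`, as provided by Mathlib for a direct sum of graded subobjects. -/
abbrev ReesAlg {K : Type*} [Field K] {n : ℕ} (d : Fin n → ℕ)
    (I : TwoSidedIdeal (FreeAlgebra K (Fin n))) : Type _ :=
  ⨁ p : ℕ, quotFiltration d I p

end WeightedFreeAlgebra

end

open scoped DirectSum

/-! Suppose the Jacobson radical of the Rees algebra is nonzero, and view the Rees algebra inside
`A[X]`. A nonzero radical element `a` with fewest homogeneous components satisfies `a_i x a_j = a_j
x a_i` for every homogeneous `x` (`mul_mul_comm_of_minimal_support`). Hence, for `β` of degree `e >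
0`, the coefficients `a_i β` of `aβ` commute. As `1 + aβ` is left invertible, the description of
units of polynomial rings over commutative rings makes every `a_p β` nilpotent
(`exists_isNilpotent_of_jacobson_ne_bot`).

On the other hand, semiprimeness of the monomial algebra extends each normal word `w` to a normal
word `w u w`. Since the leading monomials of the finite Gröbner basis have bounded length, long
overlaps can be glued, which gives `y` with all powers of `w y` normal
(`exists_forall_isNormalWord_pow`). If `w` is the leading monomial of a reduced representative of `α
≠ 0`, the `k`-th power of `α y` has a representative with leading monomial `(w y)^k`, which is
normal and so not in `LM(I)`. Thus `α y` is not nilpotent, a contradiction. -/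

namespace WeightedFreeAlgebra

/-! ### Left invertible polynomials with commuting coefficients -/

open Polynomial in
/-- If the coefficients of `b` and of a left inverse of `1 + b` come from a commutative subring,
then all coefficients of `b` of positive degree are nilpotent. -/
theorem isNilpotent_coeff_of_lifts {A Z : Type*} [Ring A] [CommRing Z] (f : Z →+* A)
    (hf : Function.Injective f) {b c : A[X]} (hb : ∀ i, ∃ z, f z = b.coeff i)
    (hcZ : ∀ i, ∃ z, f z = c.coeff i) (hc : c * (1 + b) = 1) {k : ℕ} (hk : k ≠ 0) :
    IsNilpotent (b.coeff k) := by
  obtain ⟨b', rfl⟩ : ∃ b' : Z[X], b'.map f = b :=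
    (mem_lifts b).1 ((lifts_iff_coeff_lifts b).2 hb)
  obtain ⟨c', rfl⟩ : ∃ c' : Z[X], c'.map f = c :=
    (mem_lifts c).1 ((lifts_iff_coeff_lifts c).2 hcZ)
  have hunit : c' * (1 + b') = 1 := by
    apply map_injective f hf
    rw [Polynomial.map_mul, Polynomial.map_add, Polynomial.map_one, hc]
  have := (isUnit_iff_coeff_isUnit_isNilpotent.1 (IsUnit.of_mul_eq_one_right _ hunit)).2 k hk
  rw [coeff_add, coeff_one, if_neg hk, zero_add] at this
  rw [coeff_map]
  exact this.map f

open Polynomial in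
/-- If `1 + b` has a left inverse in `A[X]`, where `b` has pairwise commuting coefficients and no
constant term, then all coefficients of `b` are nilpotent. -/
theorem isNilpotent_coeff_of_mul_one_add_eq_one {A : Type*} [Ring A] {b c : A[X]}
    (h0 : b.coeff 0 = 0) (hcomm : ∀ i j, b.coeff i * b.coeff j = b.coeff j * b.coeff i)
    (hc : c * (1 + b) = 1) (k : ℕ) : IsNilpotent (b.coeff k) := by
  rcases eq_or_ne k 0 with rfl | hk
  · rw [h0]; exact IsNilpotent.zero
  let Z : Subring A := Subring.closure (Set.range b.coeff)
  have hb : ∀ i, b.coeff i ∈ Z := fun i => Subring.subset_closure ⟨i, rfl⟩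
  -- Recursion on degree: `c = 1 - c b`, and since `b` has no constant term, the `i`-th coefficient
  -- of `c b` involves only lower coefficients of `c`.
  have hcZ : ∀ i, c.coeff i ∈ Z := by
    intro i
    induction i using Nat.strong_induction_on with
    | _ i ih =>
      have h1 : c = 1 - c * b := by rw [← hc]; noncomm_ring
      rw [h1, coeff_sub, coeff_mul, coeff_one]
      refine Z.sub_mem (by split_ifs <;> simp [Z.one_mem, Z.zero_mem]) (Z.sum_mem fun x hx => ?_)
      rw [Finset.HasAntidiagonal.mem_antidiagonal] at hx
      rcases Nat.eq_zero_or_pos x.2 with h | h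
      · rw [h, h0, mul_zero]; exact Z.zero_mem
      · exact Z.mul_mem (ih _ (by omega)) (hb _)
  have : IsMulCommutative Z := Subring.isMulCommutative_closure (by
    rintro _ ⟨i, rfl⟩ _ ⟨j, rfl⟩; exact hcomm i j)
  let _ : CommRing Z := { Z.toRing with mul_comm := IsMulCommutative.is_comm.comm }
  refine isNilpotent_coeff_of_lifts (Z := Z) Z.subtype Subtype.val_injective
    (fun i => ?_) (fun i => ?_) hc hk
  exacts [⟨⟨_, hb i⟩, rfl⟩, ⟨⟨_, hcZ i⟩, rfl⟩]

/-! ### The Jacobson radical of a Rees-type algebra inside `A[X]` -/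

section Rees

variable {K A : Type*} [CommRing K] [Ring A] [Algebra K A] (𝒜 : ℕ → Submodule K A)
  [SetLike.GradedMonoid 𝒜]

/-- The embedding `⨁ 𝒜 p → A[X]` sending `a ∈ 𝒜 p` to `a X ^ p`. -/
noncomputable def toPolynomial : (⨁ p, 𝒜 p) →+* Polynomial A :=
  DirectSum.toSemiring
    (fun p => (Polynomial.monomial p).toAddMonoidHom.comp (𝒜 p).subtype.toAddMonoidHom)
    rfl (fun _ _ => (Polynomial.monomial_mul_monomial _ _ _ _).symm)

@[simp] theorem toPolynomial_of (p : ℕ) (a : 𝒜 p) :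
    toPolynomial 𝒜 (DirectSum.of (fun p => 𝒜 p) p a) = Polynomial.monomial p (a : A) :=
  DirectSum.toSemiring_of _ _ _ _ _

theorem coeff_toPolynomial (s : ⨁ p, 𝒜 p) (k : ℕ) :
    (toPolynomial 𝒜 s).coeff k = (s k : A) := by
  induction s using DirectSum.induction_on with
  | zero => simp
  | of p a =>
    rw [toPolynomial_of, Polynomial.coeff_monomial]
    split_ifs with h
    · subst h; simp
    · rw [DirectSum.of_eq_of_ne _ _ _ (Ne.symm h)]; rfl
  | add x y hx hy => simp [hx, hy]

open Polynomial in
/-- A nonzero element of least support of a two-sided ideal of `⨁ 𝒜 p` has homogeneous components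
`a_i` with `a_i x a_j = a_j x a_i` for all homogeneous `x`. -/
theorem mul_mul_comm_of_minimal_support (J : TwoSidedIdeal (⨁ p, 𝒜 p)) {a : ⨁ p, 𝒜 p}
    (ha : a ∈ J)
    (hmin : ∀ b ∈ J, (toPolynomial 𝒜 b).support.card < (toPolynomial 𝒜 a).support.card → b = 0)
    (i j : ℕ) {e : ℕ} {x : A} (hx : x ∈ 𝒜 e) :
    (a i : A) * x * a j = a j * x * a i := by
  by_cases hi : (a i : A) = 0
  · simp [hi]
  set P := toPolynomial 𝒜 a with hP
  have hPi : P.coeff i ≠ 0 := by rwa [hP, coeff_toPolynomial]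
  let ai := DirectSum.of (fun p => 𝒜 p) i (a i)
  let x' := DirectSum.of (fun p => 𝒜 p) e ⟨x, hx⟩
  -- The coefficient of `q` in degree `m + (i + e)` is `a_i x a_m - a_m x a_i`. It vanishes for `m =
  -- i`, so `q` has fewer components than `a` and must be zero.
  let q := ai * x' * a - a * (x' * ai)
  have hq : q ∈ J := J.sub_mem (J.mul_mem_left _ _ ha) (J.mul_mem_right _ _ ha)
  have hQ : toPolynomial 𝒜 q = Polynomial.monomial (i + e) ((a i : A) * x) * P
      - P * Polynomial.monomial (i + e) (x * a i) := by
    simp only [q, ai, x', map_sub, map_mul, toPolynomial_of, ← hP, monomial_mul_monomial,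
      add_comm e i]
  have hco : ∀ m, (toPolynomial 𝒜 q).coeff (m + (i + e)) =
      (a i : A) * x * a m - a m * x * a i := by
    intro m
    rw [hQ, coeff_sub, coeff_monomial_mul, coeff_mul_monomial, hP, coeff_toPolynomial]
    noncomm_ring
  have hlow : ∀ m, m < i + e → (toPolynomial 𝒜 q).coeff m = 0 := by
    intro m hm
    rw [hQ, coeff_sub, ← C_mul_X_pow_eq_monomial, ← C_mul_X_pow_eq_monomial, ← X_pow_mul_C,
      mul_assoc, coeff_X_pow_mul', ← X_pow_mul_C, X_pow_mul_C, ← mul_assoc, coeff_mul_X_pow',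
      if_neg (by omega), if_neg (by omega), sub_zero]
  have hsub : (toPolynomial 𝒜 q).support ⊆ (P.support.erase i).image (· + (i + e)) := by
    intro m hm
    rw [mem_support_iff] at hm
    have hle : i + e ≤ m := by
      by_contra h
      exact hm (hlow m (by omega))
    obtain ⟨m, rfl⟩ := Nat.exists_eq_add_of_le' hle
    rw [hco] at hm
    refine Finset.mem_image.2 ⟨m, Finset.mem_erase.2 ⟨?_, ?_⟩, rfl⟩
    · rintro rfl; exact hm (sub_self _)
    · rw [mem_support_iff, hP, coeff_toPolynomial]
      intro h0
      simp [h0] at hm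
  have hq0 : q = 0 := by
    refine hmin q hq (lt_of_le_of_lt ((Finset.card_le_card hsub).trans Finset.card_image_le) ?_)
    exact Finset.card_erase_lt_of_mem (mem_support_iff.2 hPi)
  have := hco j
  rw [hq0, map_zero, coeff_zero] at this
  exact (sub_eq_zero.1 this.symm)

/-- If the Jacobson radical of `⨁ 𝒜 p` is nonzero, there is a nonzero homogeneous element all of
whose multiples by homogeneous elements of positive degree are nilpotent. -/
theorem exists_isNilpotent_of_jacobson_ne_bot (h : Ring.jacobson (⨁ p, 𝒜 p) ≠ ⊥) :
    ∃ α : A, α ≠ 0 ∧ ∀ e, ∀ β ∈ 𝒜 e, 0 < e → IsNilpotent (α * β) := by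
  obtain ⟨a₀, ha₀, hne₀⟩ := Submodule.exists_mem_ne_zero_of_ne_bot h
  obtain ⟨a, ⟨ha, hne⟩, hmin⟩ := (measure fun s : ⨁ p, 𝒜 p =>
    (toPolynomial 𝒜 s).support.card).wf.has_min
      {s | s ∈ Ring.jacobson (⨁ p, 𝒜 p) ∧ s ≠ 0} ⟨a₀, ha₀, hne₀⟩
  have hcomm := @mul_mul_comm_of_minimal_support K A _ _ _ 𝒜 _ (Ring.jacobson (⨁ p, 𝒜 p)).toTwoSided a
    (Ideal.mem_toTwoSided.2 ha)
    (fun b hb hlt => by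
      by_contra hb0
      exact hmin b ⟨Ideal.mem_toTwoSided.1 hb, hb0⟩ hlt)
  obtain ⟨p, hp⟩ : ∃ p, (a p : A) ≠ 0 := by
    by_contra! hall
    exact hne (DFinsupp.ext fun k => Subtype.ext (hall k))
  refine ⟨a p, hp, fun e β hβ he => ?_⟩
  let β' := DirectSum.of (fun p => 𝒜 p) e ⟨β, hβ⟩
  have hmem : a * β' ∈ Ideal.jacobson (⊥ : Ideal (⨁ p, 𝒜 p)) := by
    rw [Ideal.jacobson_bot]
    exact Ideal.mul_mem_right _ _ ha
  -- Quasi-regularity of `a β'`: here `z` is a left inverse of `1 + a β'`.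
  obtain ⟨z, hz⟩ := Ideal.mem_jacobson_iff.1 hmem 1
  have hz' : toPolynomial 𝒜 z * (1 + toPolynomial 𝒜 (a * β')) = 1 := by
    rw [Ideal.mem_bot, sub_eq_zero, mul_one] at hz
    rw [← map_one (toPolynomial 𝒜), ← map_add, ← map_mul, mul_add, mul_one, add_comm, hz]
  have hco : ∀ m, (toPolynomial 𝒜 (a * β')).coeff (m + e) = a m * β := by
    intro m
    rw [map_mul, toPolynomial_of, Polynomial.coeff_mul_monomial, coeff_toPolynomial]
  have hlow : ∀ m, m < e → (toPolynomial 𝒜 (a * β')).coeff m = 0 := by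
    intro m hm
    rw [map_mul, toPolynomial_of, ← Polynomial.C_mul_X_pow_eq_monomial, ← mul_assoc,
      Polynomial.coeff_mul_X_pow', if_neg (by omega)]
  rw [← hco p]
  refine isNilpotent_coeff_of_mul_one_add_eq_one (hlow 0 he) (fun i j => ?_) hz' _
  rcases lt_or_ge i e with hi | hi
  · rw [hlow i hi, zero_mul, mul_zero]
  rcases lt_or_ge j e with hj | hj
  · rw [hlow j hj, zero_mul, mul_zero]
  obtain ⟨i, rfl⟩ := Nat.exists_eq_add_of_le' hi
  obtain ⟨j, rfl⟩ := Nat.exists_eq_add_of_le' hj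
  rw [hco, hco, ← mul_assoc, ← mul_assoc, hcomm i j hβ]

end Rees

end WeightedFreeAlgebra

namespace WeightedFreeAlgebra

/-! ### The graded lexicographic ordering -/

section Order

variable {n : ℕ} (d : Fin n → ℕ) (r : Fin n → Fin n → Prop)

theorem gradedLex_irrefl [IsStrictTotalOrder (Fin n) r] (u : FreeMonoid (Fin n)) :
    ¬ gradedLex d r u u := by
  rintro (h | ⟨-, h⟩)
  · exact lt_irrefl _ h
  · exact Std.Asymm.asymm _ _ h h

theorem gradedLex_trans [IsStrictTotalOrder (Fin n) r] {u v w : FreeMonoid (Fin n)}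
    (h₁ : gradedLex d r u v) (h₂ : gradedLex d r v w) : gradedLex d r u w := by
  rcases h₁ with h₁ | ⟨h₁, h₁'⟩ <;> rcases h₂ with h₂ | ⟨h₂, h₂'⟩
  · exact Or.inl (by omega)
  · exact Or.inl (by omega)
  · exact Or.inl (by omega)
  · exact Or.inr ⟨by omega, List.lex_trans _root_.trans h₁' h₂'⟩

theorem gradedLex_trichotomous [IsStrictTotalOrder (Fin n) r] (u v : FreeMonoid (Fin n)) :
    gradedLex d r u v ∨ u = v ∨ gradedLex d r v u := by
  rcases lt_trichotomy (wdeg d u) (wdeg d v) with h | h | h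
  · exact Or.inl (Or.inl h)
  · rcases trichotomous_of (List.Lex r) u.toList v.toList with h' | h' | h'
    · exact Or.inl (Or.inr ⟨h, h'⟩)
    · exact Or.inr (Or.inl (FreeMonoid.toList.injective h'))
    · exact Or.inr (Or.inr (Or.inr ⟨h.symm, h'⟩))
  · exact Or.inr (Or.inr (Or.inl h))

theorem length_le_wdeg (hd : ∀ i, 0 < d i) (w : FreeMonoid (Fin n)) :
    w.toList.length ≤ wdeg d w := by
  unfold wdeg
  induction w.toList with
  | nil => simp
  | cons a l ih =>
    have := hd a
    simp only [List.length_cons, List.map_cons, List.sum_cons]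
    omega

theorem finite_setOf_gradedLex (hd : ∀ i, 0 < d i) (w : FreeMonoid (Fin n)) :
    {v | gradedLex d r v w}.Finite := by
  refine (List.finite_length_le (Fin n) (wdeg d w)).subset fun v hv => ?_
  refine (length_le_wdeg d hd v).trans ?_
  rcases hv with h | h
  · exact h.le
  · exact h.1.le

theorem gradedLex_wellFounded [IsStrictTotalOrder (Fin n) r] (hd : ∀ i, 0 < d i) :
    WellFounded (gradedLex d r) := by
  -- Positive weights leave only finitely many words below a given one, so their number serves as a
  -- rank.
  refine Subrelation.wf ?_ (measure fun w => {v | gradedLex d r v w}.ncard).wf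
  intro u v huv
  refine Set.ncard_lt_ncard ⟨fun x hx => gradedLex_trans d r hx huv, fun h => ?_⟩
    (finite_setOf_gradedLex d r hd v)
  exact gradedLex_irrefl d r u (h huv)

/-- Right multiplication can reverse a lexicographic comparison only when `u` is a proper prefix of
`v`; equal degrees and positive weights exclude this. -/
theorem lex_append_right_of_wdeg_eq (hd : ∀ i, 0 < d i) {u v : List (Fin n)}
    (h : List.Lex r u v) (huv : (u.map d).sum = (v.map d).sum) (y : List (Fin n)) :
    List.Lex r (u ++ y) (v ++ y) := by
  induction h with
  | @nil a l => have := hd a; simp at huv; omega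
  | rel h => exact List.Lex.rel h
  | cons _ ih => exact List.Lex.cons (ih (by simpa using huv))

theorem gradedLex_mul_right (hd : ∀ i, 0 < d i) {u v : FreeMonoid (Fin n)}
    (h : gradedLex d r u v) (y : FreeMonoid (Fin n)) : gradedLex d r (u * y) (v * y) := by
  rcases h with h | ⟨h, h'⟩
  · exact Or.inl (by simp only [wdeg_mul]; omega)
  · exact Or.inr ⟨by simp only [wdeg_mul]; omega, lex_append_right_of_wdeg_eq d r hd h' h _⟩

theorem gradedLex_mul_left {u v : FreeMonoid (Fin n)}
    (h : gradedLex d r u v) (x : FreeMonoid (Fin n)) : gradedLex d r (x * u) (x * v) := by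
  rcases h with h | ⟨h, h'⟩
  · exact Or.inl (by simp only [wdeg_mul]; omega)
  · exact Or.inr ⟨by simp only [wdeg_mul]; omega, List.Lex.append_left _ h' _⟩

end Order

/-! ### Coefficients in the basis of words -/

section Coeffs

variable {K : Type*} [Field K] {n : ℕ}

theorem coeffs_zero : coeffs (0 : FreeAlgebra K (Fin n)) = 0 := by simp [coeffs]

theorem coeffs_add (f g : FreeAlgebra K (Fin n)) : coeffs (f + g) = coeffs f + coeffs g := by
  simp [coeffs]

theorem coeffs_neg (f : FreeAlgebra K (Fin n)) : coeffs (-f) = -coeffs f := by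
  rw [eq_neg_iff_add_eq_zero, ← coeffs_add, neg_add_cancel, coeffs_zero]

theorem coeffs_sub (f g : FreeAlgebra K (Fin n)) : coeffs (f - g) = coeffs f - coeffs g := by
  rw [sub_eq_add_neg, coeffs_add, coeffs_neg, sub_eq_add_neg]

theorem coeffs_smul (c : K) (f : FreeAlgebra K (Fin n)) : coeffs (c • f) = c • coeffs f := by
  simp [coeffs]

theorem coeffs_eq_zero {f : FreeAlgebra K (Fin n)} : coeffs f = 0 ↔ f = 0 := by
  simp [coeffs]

theorem coeffs_monomial (w : FreeMonoid (Fin n)) :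
    coeffs (monomial K w) = Finsupp.single w 1 := by
  have : FreeAlgebra.equivMonoidAlgebraFreeMonoid (monomial K w) = MonoidAlgebra.single w 1 := by
    rw [← AlgEquiv.eq_symm_apply]
    simp [monomial, FreeAlgebra.equivMonoidAlgebraFreeMonoid]
  rw [coeffs, this, MonoidAlgebra.coeff_single]

theorem support_coeffs_monomial (w : FreeMonoid (Fin n)) :
    (coeffs (monomial K w)).support = {w} := by
  rw [coeffs_monomial, Finsupp.support_single _ one_ne_zero]

theorem monomial_mul (u v : FreeMonoid (Fin n)) :
    monomial K (u * v) = monomial K u * monomial K v := map_mul _ _ _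

theorem sum_coeffs (f : FreeAlgebra K (Fin n)) :
    f = ∑ w ∈ (coeffs f).support, coeffs f w • monomial K w := by
  rw [← sub_eq_zero, ← coeffs_eq_zero]
  have hs : ∀ s : Finset (FreeMonoid (Fin n)),
      coeffs (∑ w ∈ s, coeffs f w • monomial K w) = ∑ w ∈ s, Finsupp.single w (coeffs f w) := by
    intro s
    classical
    induction s using Finset.induction_on with
    | empty => simp [coeffs_zero]
    | insert a s ha ih =>
      rw [Finset.sum_insert ha, coeffs_add, ih, coeffs_smul, coeffs_monomial, Finset.sum_insert ha]
      simp
  rw [coeffs_sub, hs, sub_eq_zero]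
  exact (Finsupp.sum_single (coeffs f)).symm

theorem support_coeffs_mul {f g : FreeAlgebra K (Fin n)} {w : FreeMonoid (Fin n)}
    (hw : w ∈ (coeffs (f * g)).support) :
    ∃ u ∈ (coeffs f).support, ∃ v ∈ (coeffs g).support, u * v = w := by
  classical
  rw [Finsupp.mem_support_iff] at hw
  by_contra! h
  apply hw
  rw [coeffs, map_mul, MonoidAlgebra.coeff_mul]
  refine Finset.sum_eq_zero fun u hu => Finset.sum_eq_zero fun v hv => ?_
  exact if_neg (h u hu v hv)

end Coeffs

/-! ### Leading monomials and reduction modulo an ideal -/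

section LeadingMonomial

variable {K : Type*} [Field K] {n : ℕ} {d : Fin n → ℕ} {r : Fin n → Fin n → Prop}

theorem isLeadingMonomial_monomial (lt : FreeMonoid (Fin n) → FreeMonoid (Fin n) → Prop)
    (w : FreeMonoid (Fin n)) : IsLeadingMonomial lt (monomial K w) w := by
  classical
  rw [IsLeadingMonomial, coeffs_monomial]
  refine ⟨by simp, fun u hu hne => absurd ?_ hne⟩
  rw [Finsupp.mem_support_iff, Finsupp.single_apply] at hu
  by_contra h
  exact hu (if_neg fun h' => h h'.symm)

variable [IsStrictTotalOrder (Fin n) r]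

theorem exists_isLeadingMonomial {f : FreeAlgebra K (Fin n)} (hf : f ≠ 0) :
    ∃ w, IsLeadingMonomial (gradedLex d r) f w := by
  classical
  have key : ∀ s : Finset (FreeMonoid (Fin n)), s.Nonempty →
      ∃ w ∈ s, ∀ u ∈ s, u ≠ w → gradedLex d r u w := by
    intro s hs
    induction hs using Finset.Nonempty.cons_induction with
    | singleton a => exact ⟨a, by simp⟩
    | cons a s ha hs ih =>
      obtain ⟨w, hw, hmax⟩ := ih
      rcases gradedLex_trichotomous d r a w with h | rfl | h
      · refine ⟨w, by simp [hw], fun u hu hne => ?_⟩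
        rcases Finset.mem_cons.1 hu with rfl | hu
        exacts [h, hmax u hu hne]
      · exact absurd hw ha
      · refine ⟨a, by simp, fun u hu hne => ?_⟩
        have hu := (Finset.mem_cons.1 hu).resolve_left hne
        by_cases huw : u = w
        · rwa [huw]
        · exact gradedLex_trans d r (hmax u hu huw) h
  refine key _ (Finsupp.support_nonempty_iff.2 fun h => hf (coeffs_eq_zero.1 h))

theorem IsLeadingMonomial.unique {f : FreeAlgebra K (Fin n)} {u v : FreeMonoid (Fin n)}
    (hu : IsLeadingMonomial (gradedLex d r) f u) (hv : IsLeadingMonomial (gradedLex d r) f v) :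
    u = v := by
  by_contra h
  exact gradedLex_irrefl d r u
    (gradedLex_trans d r (hv.2 u hu.1 h) (hu.2 v hv.1 (Ne.symm h)))

theorem IsLeadingMonomial.mul (hd : ∀ i, 0 < d i) {f g : FreeAlgebra K (Fin n)}
    {u v : FreeMonoid (Fin n)} (hu : IsLeadingMonomial (gradedLex d r) f u)
    (hv : IsLeadingMonomial (gradedLex d r) g v) :
    IsLeadingMonomial (gradedLex d r) (f * g) (u * v) := by
  have key : ∀ a ∈ (coeffs f).support, ∀ b ∈ (coeffs g).support, (a ≠ u ∨ b ≠ v) →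
      gradedLex d r (a * b) (u * v) := by
    intro a ha b hb h
    by_cases hau : a = u
    · subst hau
      exact gradedLex_mul_left d r (hv.2 b hb (h.resolve_left (not_not.2 rfl))) _
    · have h1 := gradedLex_mul_right d r hd (hu.2 a ha hau) b
      by_cases hbv : b = v
      · rwa [hbv] at h1 ⊢
      · exact gradedLex_trans d r h1 (gradedLex_mul_left d r (hv.2 b hb hbv) _)
  constructor
  -- By `key`, only the pair `(u, v)` contributes to the word `u * v`, so its coefficient is a
  -- product of two nonzero scalars.
  · rw [Finsupp.mem_support_iff, coeffs, map_mul FreeAlgebra.equivMonoidAlgebraFreeMonoid,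
      MonoidAlgebra.coeff_mul_mul_of_uniqueMul]
    · exact mul_ne_zero (Finsupp.mem_support_iff.1 hu.1) (Finsupp.mem_support_iff.1 hv.1)
    · intro a b ha hb hab
      by_contra h
      have := key a ha b hb (by tauto)
      rw [hab] at this
      exact gradedLex_irrefl d r _ this
  · intro w hw hne
    obtain ⟨a, ha, b, hb, rfl⟩ := support_coeffs_mul hw
    refine key a ha b hb ?_
    by_contra! h
    exact hne (by rw [h.1, h.2])

theorem IsLeadingMonomial.pow (hd : ∀ i, 0 < d i) {f : FreeAlgebra K (Fin n)}
    {u : FreeMonoid (Fin n)} (hu : IsLeadingMonomial (gradedLex d r) f u) (k : ℕ) :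
    IsLeadingMonomial (gradedLex d r) (f ^ k) (u ^ k) := by
  induction k with
  | zero =>
    have := isLeadingMonomial_monomial (K := K) (gradedLex d r) 1
    rwa [monomial, map_one] at this
  | succ k ih => rw [pow_succ, pow_succ]; exact ih.mul hd hu

/-- Every element outside `I` is congruent modulo `I` to one whose leading monomial is not a
leading monomial of `I`. -/
theorem exists_sub_mem_isLeadingMonomial (hd : ∀ i, 0 < d i)
    (I : TwoSidedIdeal (FreeAlgebra K (Fin n))) {f : FreeAlgebra K (Fin n)} (hf : f ∉ I) :
    ∃ g w, f - g ∈ I ∧ IsLeadingMonomial (gradedLex d r) g w ∧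
      w ∉ leadingMonomials (gradedLex d r) {f | f ∈ I} := by
  -- Take a representative of the coset with least leading monomial `w`. Were `w` in `LM(I)`,
  -- cancelling it with a multiple of some `h ∈ I` would give a smaller one.
  obtain ⟨w, ⟨g, hg, hw⟩, hmin⟩ := (gradedLex_wellFounded d r hd).has_min
    {w | ∃ g, f - g ∈ I ∧ IsLeadingMonomial (gradedLex d r) g w} (by
      obtain ⟨w, hw⟩ := exists_isLeadingMonomial (d := d) (r := r) (f := f)
        (by rintro rfl; exact hf I.zero_mem)
      exact ⟨w, f, by rw [sub_self]; exact I.zero_mem, hw⟩)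
  refine ⟨g, w, hg, hw, ?_⟩
  rintro ⟨h, hI, hh⟩
  have hI : h ∈ I := hI
  set c := coeffs g w / coeffs h w with hc
  have hcI : c • h ∈ I := by
    rw [Algebra.smul_def]; exact I.mul_mem_left _ _ hI
  have hg' : f - (g - c • h) ∈ I := by
    rw [← sub_add]; exact I.add_mem hg hcI
  have hne : g - c • h ≠ 0 := by
    intro h0
    rw [h0, sub_zero] at hg'
    exact hf hg'
  obtain ⟨v, hv⟩ := exists_isLeadingMonomial (d := d) (r := r) hne
  have hco : ∀ x, coeffs (g - c • h) x = coeffs g x - c * coeffs h x := by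
    intro x; rw [coeffs_sub, coeffs_smul]; rfl
  have hvw : v ≠ w := by
    rintro rfl
    refine Finsupp.mem_support_iff.1 hv.1 ?_
    rw [hco, hc, div_mul_cancel₀ _ (Finsupp.mem_support_iff.1 hh.1), sub_self]
  refine hmin v ⟨_, hg', hv⟩ ?_
  by_cases hvg : v ∈ (coeffs g).support
  · exact hw.2 v hvg hvw
  · refine hh.2 v ?_ hvw
    rw [Finsupp.notMem_support_iff] at hvg
    rw [Finsupp.mem_support_iff]
    intro h0
    refine Finsupp.mem_support_iff.1 hv.1 ?_
    rw [hco, hvg, h0, mul_zero, sub_zero]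

end LeadingMonomial

end WeightedFreeAlgebra

namespace WeightedFreeAlgebra

/-! ### Normal words and their powers -/

section Words

variable {n : ℕ}

/-- A word is normal modulo a set of words `Ω` if no element of `Ω` is a factor of it. -/
def IsNormalWord (Ω : Set (FreeMonoid (Fin n))) (w : FreeMonoid (Fin n)) : Prop :=
  ∀ v ∈ Ω, ¬ WordDvd v w

theorem WordDvd.mul {v w : FreeMonoid (Fin n)} (h : WordDvd v w) (x y : FreeMonoid (Fin n)) :
    WordDvd v (x * w * y) := by
  obtain ⟨p, q, rfl⟩ := h
  exact ⟨x * p, q * y, by simp only [mul_assoc]⟩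

theorem IsNormalWord.of_mul {Ω : Set (FreeMonoid (Fin n))} {x w y : FreeMonoid (Fin n)}
    (h : IsNormalWord Ω (x * w * y)) : IsNormalWord Ω w :=
  fun v hv hw => h v hv (hw.mul x y)

/-- Two normal words which overlap in a sufficiently long word can be glued. -/
theorem IsNormalWord.glue {Ω : Set (FreeMonoid (Fin n))} {x w z : FreeMonoid (Fin n)}
    (hΩ : ∀ v ∈ Ω, v.toList.length ≤ w.toList.length) (h₁ : IsNormalWord Ω (x * w))
    (h₂ : IsNormalWord Ω (w * z)) : IsNormalWord Ω (x * w * z) := by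
  rintro v hv ⟨p, q, hpq⟩
  have hlen := hΩ v hv
  have hpq' : x.toList ++ (w.toList ++ z.toList) = p.toList ++ (v.toList ++ q.toList) := by
    have := congrArg FreeMonoid.toList hpq
    simpa only [FreeMonoid.toList_mul, List.append_assoc] using this
  -- An occurrence of `v` starting after `x` lies in `w z`. One starting within `x` either ends
  -- within `x w`, or contains all of `w`; in the last case the length bound forces `v = w`.
  rcases List.append_eq_append_iff.1 hpq' with ⟨as, hp, h⟩ | ⟨bs, hx, h⟩
  · exact h₂ v hv ⟨FreeMonoid.ofList as, q, FreeMonoid.toList.injective (by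
      simpa only [FreeMonoid.toList_mul, FreeMonoid.toList_ofList, List.append_assoc] using h)⟩
  · rw [← List.append_assoc] at h
    rcases List.append_eq_append_iff.1 h with ⟨as, hp, h'⟩ | ⟨cs, hb, h'⟩
    · refine h₁ v hv ⟨p, FreeMonoid.ofList as, FreeMonoid.toList.injective ?_⟩
      simp only [FreeMonoid.toList_mul, FreeMonoid.toList_ofList, hx, List.append_assoc, hp]
    · have hle := congrArg List.length hb
      simp only [List.length_append] at hle
      have hbs : bs = [] := List.eq_nil_of_length_eq_zero (by omega)
      have hcs : cs = [] := List.eq_nil_of_length_eq_zero (by omega)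
      subst hbs hcs
      refine h₁ v hv ⟨p, 1, FreeMonoid.toList.injective ?_⟩
      simp only [List.nil_append, List.append_nil] at hb hx
      simp only [FreeMonoid.toList_mul, FreeMonoid.toList_one, List.append_nil, hx, hb]

/-- If every normal word `w` has a normal word `w u w`, and the elements of `Ω` have bounded length,
then every normal word has a right multiple all of whose powers are normal. -/
theorem exists_forall_isNormalWord_pow {Ω : Set (FreeMonoid (Fin n))} {m : ℕ}
    (hm : ∀ v ∈ Ω, v.toList.length ≤ m)
    (hext : ∀ w, IsNormalWord Ω w → ∃ u, IsNormalWord Ω (w * u * w))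
    {w : FreeMonoid (Fin n)} (hw : IsNormalWord Ω w) :
    ∃ y, ∀ k, IsNormalWord Ω ((w * y) ^ k) := by
  by_cases hw1 : w = 1
  · exact ⟨1, fun k => by rw [hw1, mul_one, one_pow, ← hw1]; exact hw⟩
  have hpos : 0 < w.toList.length :=
    List.length_pos_iff.2 fun h => hw1 (FreeMonoid.toList.injective h)
  -- Passing from `w z` to `w z u w z` strictly increases the length, as `w` is nonempty.
  have hlong : ∀ N, ∃ z, IsNormalWord Ω (w * z) ∧ N ≤ (w * z).toList.length := by
    intro N
    induction N with
    | zero => exact ⟨1, by rwa [mul_one], Nat.zero_le _⟩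
    | succ N ih =>
      obtain ⟨z, hz, hN⟩ := ih
      obtain ⟨u, hu⟩ := hext _ hz
      refine ⟨z * u * (w * z), by simpa only [mul_assoc] using hu, ?_⟩
      simp only [FreeMonoid.toList_mul, List.length_append] at hN ⊢
      omega
  obtain ⟨z, hz, hN⟩ := hlong m
  obtain ⟨u, hu⟩ := hext _ hz
  -- Each step glues on the normal word `w z u w z` along `w z`, which is long enough by the choice
  -- of `z`.
  have hpow : ∀ k, IsNormalWord Ω ((w * z * u) ^ k * (w * z)) := by
    intro k
    induction k with
    | zero => simpa using hz
    | succ k ih =>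
      have := IsNormalWord.glue (fun v hv => (hm v hv).trans hN) ih
        (z := u * (w * z)) (by rwa [← mul_assoc])
      rw [pow_succ]
      simpa only [mul_assoc] using this
  refine ⟨z * u, fun k => IsNormalWord.of_mul (x := 1) (y := w * z) ?_⟩
  rw [one_mul, ← mul_assoc w z u]
  exact hpow k

end Words

/-! ### Monomial ideals and semiprimeness -/

section MonomialIdeal

variable {K : Type*} [Field K] {n : ℕ}

theorem mem_monomialIdeal_iff {Ω : Set (FreeMonoid (Fin n))} {f : FreeAlgebra K (Fin n)} :
    f ∈ monomialIdeal K Ω ↔ ∀ w ∈ (coeffs f).support, ∃ v ∈ Ω, WordDvd v w := by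
  constructor
  · intro hf
    refine TwoSidedIdeal.span_induction
      (p := fun f _ => ∀ w ∈ (coeffs f).support, ∃ v ∈ Ω, WordDvd v w) ?_ ?_ ?_ ?_ ?_ ?_ hf
    · rintro _ ⟨v, hv, rfl⟩ w hw
      by_cases h : w = v
      · exact ⟨v, hv, 1, 1, by simp [h]⟩
      · rw [coeffs_monomial, Finsupp.mem_support_iff, Finsupp.single_eq_of_ne h] at hw
        exact absurd rfl hw
    · intro w hw
      simp [coeffs_zero] at hw
    · intro x y _ _ hx hy w hw
      classical
      rw [coeffs_add] at hw
      rcases Finset.mem_union.1 (Finsupp.support_add hw) with h | h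
      exacts [hx w h, hy w h]
    · intro x _ hx w hw
      rw [coeffs_neg, Finsupp.support_neg] at hw
      exact hx w hw
    · intro a x _ hx w hw
      obtain ⟨s, -, t, ht, rfl⟩ := support_coeffs_mul hw
      obtain ⟨v, hv, hvt⟩ := hx t ht
      exact ⟨v, hv, by simpa using hvt.mul s 1⟩
    · intro b x _ hx w hw
      obtain ⟨s, hs, t, -, rfl⟩ := support_coeffs_mul hw
      obtain ⟨v, hv, hvs⟩ := hx s hs
      exact ⟨v, hv, by simpa using hvs.mul 1 t⟩
  · intro h
    rw [sum_coeffs f]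
    refine sum_mem fun w hw => ?_
    obtain ⟨v, hv, p, q, rfl⟩ := h w hw
    rw [Algebra.smul_def, monomial_mul, monomial_mul]
    exact TwoSidedIdeal.mul_mem_left _ _ _ (TwoSidedIdeal.mul_mem_right _ _ _
      (TwoSidedIdeal.mul_mem_left _ _ _ (TwoSidedIdeal.subset_span ⟨v, hv, rfl⟩)))

theorem monomial_mem_monomialIdeal_iff {Ω : Set (FreeMonoid (Fin n))} {w : FreeMonoid (Fin n)} :
    monomial K w ∈ monomialIdeal K Ω ↔ ¬ IsNormalWord Ω w := by
  rw [mem_monomialIdeal_iff, support_coeffs_monomial]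
  simp [IsNormalWord]

/-- If no `w u w` were normal, the class `a` of `w` in the monomial algebra `R` would satisfy `a R a
= 0`, hence vanish, contradicting normality of `w`. -/
theorem exists_isNormalWord_mul_mul {Ω : Set (FreeMonoid (Fin n))}
    (hsp : IsSemiprimeRing (QuotAlg (monomialIdeal K Ω))) {w : FreeMonoid (Fin n)}
    (hw : IsNormalWord Ω w) : ∃ u, IsNormalWord Ω (w * u * w) := by
  by_contra! h
  have h0 : QuotAlg.mk (monomialIdeal K Ω) (monomial K w) = 0 := by
    refine hsp _ fun x => ?_
    obtain ⟨f, rfl⟩ := QuotAlg.mk_surjective _ x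
    rw [← map_mul, ← map_mul, QuotAlg.mk_eq_zero, mem_monomialIdeal_iff]
    intro z hz
    obtain ⟨s, hs, t, ht, rfl⟩ := support_coeffs_mul hz
    obtain ⟨a, ha, u, -, rfl⟩ := support_coeffs_mul hs
    rw [support_coeffs_monomial,
      Finset.mem_singleton] at ha ht
    subst ha ht
    have := h u
    rw [IsNormalWord] at this
    push Not at this
    exact this
  rw [QuotAlg.mk_eq_zero, monomial_mem_monomialIdeal_iff] at h0
  exact h0 hw

end MonomialIdeal

/-! ### Non-nilpotent multiples in the quotient algebra -/

section Main

variable {K : Type*} [Field K] {n : ℕ} {d : Fin n → ℕ} {r : Fin n → Fin n → Prop}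

theorem exists_length_le_of_finite [IsStrictTotalOrder (Fin n) r]
    {G : Set (FreeAlgebra K (Fin n))} (hfin : G.Finite) :
    ∃ m, ∀ v ∈ leadingMonomials (gradedLex d r) G, v.toList.length ≤ m := by
  have hLM : (leadingMonomials (gradedLex d r) G).Finite := by
    have : leadingMonomials (gradedLex d r) G =
        ⋃ f ∈ G, {w | IsLeadingMonomial (gradedLex d r) f w} := by
      ext w; simp [leadingMonomials]
    rw [this]
    exact hfin.biUnion fun f _ => Set.Subsingleton.finite fun u hu v hv => hu.unique hv
  obtain ⟨m, hm⟩ := (hLM.image fun v => v.toList.length).bddAbove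
  exact ⟨m, fun v hv => hm ⟨v, hv, rfl⟩⟩

theorem isNormalWord_of_notMem_leadingMonomials [IsStrictTotalOrder (Fin n) r]
    (hd : ∀ i, 0 < d i) {I : TwoSidedIdeal (FreeAlgebra K (Fin n))}
    {G : Set (FreeAlgebra K (Fin n))} (hG : G ⊆ I) {w : FreeMonoid (Fin n)}
    (hw : w ∉ leadingMonomials (gradedLex d r) {f | f ∈ I}) :
    IsNormalWord (leadingMonomials (gradedLex d r) G) w := by
  rintro v ⟨g, hg, hv⟩ ⟨p, q, rfl⟩
  refine hw ⟨monomial K p * g * monomial K q,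
    I.mul_mem_right _ _ (I.mul_mem_left _ _ (hG hg)), ?_⟩
  exact ((isLeadingMonomial_monomial _ p).mul hd hv).mul hd (isLeadingMonomial_monomial _ q)

theorem IsGroebnerBasis.notMem_leadingMonomials {I : TwoSidedIdeal (FreeAlgebra K (Fin n))}
    {G : Set (FreeAlgebra K (Fin n))} (hG : IsGroebnerBasis (gradedLex d r) I G)
    {w : FreeMonoid (Fin n)} (hw : IsNormalWord (leadingMonomials (gradedLex d r) G) w) :
    w ∉ leadingMonomials (gradedLex d r) {f | f ∈ I} := by
  intro h
  refine (monomial_mem_monomialIdeal_iff (K := K)).1 ?_ hw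
  rw [← hG.2]
  exact TwoSidedIdeal.subset_span ⟨w, h, rfl⟩

/-- Over a finite Gröbner basis with semiprime associated monomial algebra, every nonzero element of
the quotient algebra has a non-nilpotent right multiple by a word. -/
theorem IsGroebnerBasis.exists_not_isNilpotent_mul_monomial [IsStrictTotalOrder (Fin n) r]
    (hd : ∀ i, 0 < d i) {I : TwoSidedIdeal (FreeAlgebra K (Fin n))}
    {G : Set (FreeAlgebra K (Fin n))} (hfin : G.Finite)
    (hG : IsGroebnerBasis (gradedLex d r) I G)
    (hsp : IsSemiprimeRing (QuotAlg (monomialIdeal K (leadingMonomials (gradedLex d r) G))))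
    {α : QuotAlg I} (hα : α ≠ 0) :
    ∃ y, ¬ IsNilpotent (α * QuotAlg.mk I (monomial K y)) := by
  obtain ⟨f, rfl⟩ := QuotAlg.mk_surjective I α
  rw [Ne, QuotAlg.mk_eq_zero] at hα
  obtain ⟨g, w, hfg, hgw, hw⟩ := exists_sub_mem_isLeadingMonomial (d := d) (r := r) hd I hα
  rw [← QuotAlg.mk_eq_zero, map_sub, sub_eq_zero] at hfg
  obtain ⟨m, hm⟩ := exists_length_le_of_finite (d := d) (r := r) hfin
  obtain ⟨y, hy⟩ := exists_forall_isNormalWord_pow hm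
    (fun w hw => exists_isNormalWord_mul_mul hsp hw)
    (isNormalWord_of_notMem_leadingMonomials hd (fun g hg => (hG.1 g hg).1) hw)
  refine ⟨y, ?_⟩
  rintro ⟨k, hk⟩
  rw [hfg, ← map_mul, ← map_pow, QuotAlg.mk_eq_zero] at hk
  exact hG.notMem_leadingMonomials (hy k)
    ⟨_, hk, (hgw.mul hd (isLeadingMonomial_monomial _ y)).pow hd k⟩

theorem mk_monomial_mem_quotFiltration (I : TwoSidedIdeal (FreeAlgebra K (Fin n)))
    {w : FreeMonoid (Fin n)} {p : ℕ} (hw : wdeg d w ≤ p) :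
    QuotAlg.mk I (monomial K w) ∈ quotFiltration d I p :=
  ⟨monomial K w, Submodule.mem_iSup_of_mem (wdeg d w) (Submodule.mem_iSup_of_mem hw
    (Submodule.subset_span ⟨w, rfl, rfl⟩)), rfl⟩

end Main

end WeightedFreeAlgebra
theorem theorem3p5 {K : Type*} [Field K] (n : ℕ)
    (d : Fin n → ℕ) (hd : ∀ i, 0 < d i)
    (r : Fin n → Fin n → Prop) [IsStrictTotalOrder (Fin n) r]
    (G : Set (FreeAlgebra K (Fin n))) (hfin : G.Finite)
    (hG : WeightedFreeAlgebra.IsGroebnerBasis (WeightedFreeAlgebra.gradedLex d r)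
      (TwoSidedIdeal.span G) G)
    (hX : Disjoint (WeightedFreeAlgebra.leadingMonomials (WeightedFreeAlgebra.gradedLex d r) G)
      (Set.range FreeMonoid.of))
    (hred : WeightedFreeAlgebra.IsReducedWordSet
      (WeightedFreeAlgebra.leadingMonomials (WeightedFreeAlgebra.gradedLex d r) G))
    (hsp : WeightedFreeAlgebra.IsSemiprimeRing
      (WeightedFreeAlgebra.QuotAlg (WeightedFreeAlgebra.monomialIdeal K
        (WeightedFreeAlgebra.leadingMonomials (WeightedFreeAlgebra.gradedLex d r) G)))) :
    WeightedFreeAlgebra.IsSemiprimitiveRing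
      (WeightedFreeAlgebra.ReesAlg d (TwoSidedIdeal.span G)) := by
  by_contra h
  obtain ⟨α, hα, hnil⟩ := WeightedFreeAlgebra.exists_isNilpotent_of_jacobson_ne_bot
    (WeightedFreeAlgebra.quotFiltration d (TwoSidedIdeal.span G)) h
  obtain ⟨y, hy⟩ := hG.exists_not_isNilpotent_mul_monomial hd hfin hsp hα
  -- The word `y` may be empty, so it is placed in filtration degree `wdeg d y + 1` to keep that
  -- degree positive.
  exact hy (hnil _ _ (WeightedFreeAlgebra.mk_monomial_mem_quotFiltration _
    (Nat.le_succ (WeightedFreeAlgebra.wdeg d y))) (Nat.succ_pos _))
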